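/- **Conventions.** A relation schema $R$ is a finite set of attributes, each with an infinite domain. A relation over $R$ is a set of tuples over $R$ (a tuple assigns to each attribute a value of its domain). For $X,Y\subseteq R$, a relation $r$ satisfies the key $k(X)$ if any two tuples of $r$ that agree on $X$ are equal, and it satisfies the independence atom $X\perp Y$ if for all $t,t'\in r$ there is $t''\in r$ that agrees with $t$ on $X$ and with $t'$ on $Y$. The atom is unary if $X$ and $Y$ are single attributes. For a set $\Sigma\cup\{\varphi\}$ of keys and independence atoms over $R$, $\Sigma\models_{\mathrm{FIN}}\varphi$ means that every finite relation over $R$ satisfying all of $\Sigma$ satisfies $\varphi$; $\varphi$ is an $m$-ary finite implication of $\Sigma$ if $\Sigma'\models_{\mathrm{FIN}}\varphi$ for some $\Sigma'\subseteq\Sigma$ with $|\Sigma'|\le m$. An inference rule has a fixed finite number of premises and one conclusion, and is given by an arbitrary collection of instances over each schema. For a set $\mathfrak I$ of rules, $\Sigma\vdash_{\mathfrak I}\varphi$ means that there is a finite sequence of constraints ending in $\varphi$, each of which is in $\Sigma$ or is the conclusion of an instance of a rule of $\mathfrak I$ whose premises occur earlier in the sequence. $\mathfrak I$ is $k$-ary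 if each of its rules has at most $k$ premises. For a class of constraints, $\mathfrak I$ is sound (complete) for its finite implication problem if, over every schema and for all $\Sigma\cup\{\varphi\}$ in the class, $\Sigma\vdash_{\mathfrak I}\varphi$ implies $\Sigma\models_{\mathrm{FIN}}\varphi$ (respectively, the converse), where all members of the sequences are taken from the class. **Theorem.** 1. For no natural number $k$ is there a $k$-ary set of inference rules that is sound and complete for the finite implication problem for keys and unary independence atoms. 2. The same holds if arbitrary independence atoms may occur in inferences: for no natural number $k$ is there a $k$-ary set $\mathfrak I$ of rules that is sound for the finite implication problem for keys and arbitrary independence atoms and such that $\Sigma\models_{\mathrm{FIN}}\varphi$ implies $\Sigma\vdash_{\mathfrak I}\varphi$ (by a sequence of keys and arbitrary independence atoms) whenever $\Sigma\cup\{\varphi\}$ consists of keys and unary independence atoms. 3. For $n\ge 2$ let $R_n=\{A_1,B_1,\dots,A_n,B_n\}$ be a schema with $2n$ distinct attributes, let $\Sigma_n=\{A_i\perp B_i : 1\le i\le n\}\cup\{k(B_iA_{i+1}) : 1\le i\le n\}$ with $A_{n+1}=A_1$, and let $C_n$ be $\Sigma_n$ together with all atoms $B_i\perp A_i$ and all keys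 $k(D)$ with $D\subseteq R_n$ and $k(C)\in\Sigma_n$ for some $C\subseteq D$. Then $\Sigma_n\models_{\mathrm{FIN}}k(A_1B_1)$, whereas $k(A_1B_1)\notin C_n$, and every key or unary independence atom over $R_n$ that is a $(2n-1)$-ary finite implication of $C_n$ belongs to $C_n$. -/

import Mathlib

namespace KeyIndep

/-- A relation schema: a finite set of attributes, each equipped with an (infinite) domain
of possible values. -/
structure RelationSchema where
  Attr : Type
  Dom : Attr → Type
  finite_attr : Finite Attr
  infinite_dom : ∀ A, Infinite (Dom A)

/-- A tuple over `R` picks for every attribute a value of its domain. -/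
abbrev Tuple (R : RelationSchema) : Type := ∀ A : R.Attr, R.Dom A

/-- A relation over `R`: a (possibly infinite) set of tuples over `R`. -/
abbrev Relation (R : RelationSchema) : Type := Set (Tuple R)

/-- `t(X) = t'(X)`. -/
def AgreeOn {R : RelationSchema} (X : Set R.Attr) (t t' : Tuple R) : Prop :=
  ∀ A ∈ X, t A = t' A

/-- The constraints over `R`: keys `k(X)` and independence atoms `X ⊥ Y`. -/
inductive Constraint (R : RelationSchema) : Type
  | key (X : Set R.Attr) : Constraint R
  | indep (X Y : Set R.Attr) : Constraint R

/-- Satisfaction of a constraint in a relation. -/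
def Satisfies {R : RelationSchema} (r : Relation R) : Constraint R → Prop
  | .key X => ∀ t ∈ r, ∀ t' ∈ r, AgreeOn X t t' → t = t'
  | .indep X Y => ∀ t ∈ r, ∀ t' ∈ r, ∃ t'' ∈ r, AgreeOn X t'' t ∧ AgreeOn Y t'' t'

/-- Finite implication: every finite relation satisfying all of `S` satisfies `φ`. -/
def FinImplies {R : RelationSchema} (S : Set (Constraint R)) (φ : Constraint R) : Prop :=
  ∀ r : Relation R, r.Finite → (∀ σ ∈ S, Satisfies r σ) → Satisfies r φ

/-- `φ` is a `k`-ary finite implication of `S`. -/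
def IsKaryFinImplication {R : RelationSchema} (k : ℕ) (S : Set (Constraint R))
    (φ : Constraint R) : Prop :=
  ∃ S' ⊆ S, S'.encard ≤ (k : ℕ∞) ∧ FinImplies S' φ

/-- A class of constraints, over every relation schema. -/
abbrev ConstraintClass : Type 1 := ∀ R : RelationSchema, Set (Constraint R)

/-- All keys and all unary independence atoms `A ⊥ B` (`A`, `B` single attributes). -/
def keysAndUnaryAtoms : ConstraintClass := fun _ =>
  {φ | (∃ X, φ = .key X) ∨ ∃ A B, φ = .indep {A} {B}}

/-- All keys and all independence atoms. -/
def keysAndAtoms : ConstraintClass := fun _ => Set.univ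

/-- An inference rule with `arity` many premises and one conclusion, given by its instances over
each relation schema. Nothing is assumed about the shape of the set of instances. -/
structure InferenceRule where
  arity : ℕ
  Instance : ∀ R : RelationSchema, (Fin arity → Constraint R) → Constraint R → Prop

/-- `φ` can be inferred from `S` by the rules in `I`, within the class `L`: there is a sequence
`γ 0, …, γ m = φ` of constraints in `L`, each of which is an element of `S` or the conclusion of an
instance of a rule whose premises all occur earlier in the sequence. -/
def Infers (L : ConstraintClass) (I : Set InferenceRule) {R : RelationSchema}
    (S : Set (Constraint R)) (φ : Constraint R) : Prop :=
  ∃ (m : ℕ) (γ : Fin (m + 1) → Constraint R), γ (Fin.last m) = φ ∧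
    ∀ i, γ i ∈ L R ∧
      (γ i ∈ S ∨ ∃ ρ ∈ I, ∃ p : Fin ρ.arity → Constraint R,
        (∀ j, ∃ i' < i, p j = γ i') ∧ ρ.Instance R p (γ i))

/-- Inference within `L` is sound for finite implication of constraints in `L`. -/
def FinSound (L : ConstraintClass) (I : Set InferenceRule) : Prop :=
  ∀ (R : RelationSchema) (S : Set (Constraint R)) (φ : Constraint R),
    S ⊆ L R → φ ∈ L R → Infers L I S φ → FinImplies S φ

/-- Inference within `L` is complete for finite implication of constraints in `C`. -/
def FinComplete (L C : ConstraintClass) (I : Set InferenceRule) : Prop :=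
  ∀ (R : RelationSchema) (S : Set (Constraint R)) (φ : Constraint R),
    S ⊆ C R → φ ∈ C R → FinImplies S φ → Infers L I S φ

/-- Every rule in `I` has at most `k` premises. -/
def IsKary (k : ℕ) (I : Set InferenceRule) : Prop := ∀ ρ ∈ I, ρ.arity ≤ k

/-- The schema with attributes `A_i = Sum.inl i` and `B_i = Sum.inr i` for `i : Fin n`
(indices run through `0, …, n - 1`), with arbitrary infinite domains. -/
def smileySchema (n : ℕ) (D : Fin n ⊕ Fin n → Type) [∀ a, Infinite (D a)] : RelationSchema where
  Attr := Fin n ⊕ Fin n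
  Dom := D
  finite_attr := inferInstance
  infinite_dom := inferInstance

section Smiley

variable {n : ℕ} (D : Fin n ⊕ Fin n → Type) [∀ a, Infinite (D a)]

/-- The attribute `A_i`. -/
def attrA (i : Fin n) : (smileySchema n D).Attr := (Sum.inl i : Fin n ⊕ Fin n)

/-- The attribute `B_i`. -/
def attrB (i : Fin n) : (smileySchema n D).Attr := (Sum.inr i : Fin n ⊕ Fin n)

/-- The index `i + 1` modulo `n`. -/
def cyclicSucc (i : Fin n) : Fin n := ⟨(i.1 + 1) % n, Nat.mod_lt _ i.pos⟩

/-- `Σ_n`: the atoms `A_i ⊥ B_i` and the keys `k(B_i A_{i+1})`, indices modulo `n`. -/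
def smiley : Set (Constraint (smileySchema n D)) :=
  {φ | (∃ i : Fin n, φ = .indep {attrA D i} {attrB D i}) ∨
    ∃ i : Fin n, φ = .key {attrB D i, attrA D (cyclicSucc i)}}

end Smiley

/-- The upward closure with respect to keys, with independence atoms read up to symmetry: it adds
to `S` all `k(X')` with `X ⊆ X'`, `k(X) ∈ S`, and all `Y ⊥ X` with `X ⊥ Y ∈ S`. -/
def upwardClosure {R : RelationSchema} (S : Set (Constraint R)) : Set (Constraint R) :=
  S ∪ {φ | ∃ X X', X ⊆ X' ∧ Constraint.key X ∈ S ∧ φ = .key X'}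
    ∪ {φ | ∃ X Y, Constraint.indep X Y ∈ S ∧ φ = .indep Y X}

end KeyIndep

open KeyIndep

/-! In a finite nonempty `r`, the atoms give `|r(A_j)| |r(B_j)| ≤ |r|` and the keys give `|r| ≤
|r(B_j)| |r(A_{j+1})|`. Around the cycle both families have the same product, so every inequality is
an equality and `A_i B_i` is a key (`finImplies_smiley`).

All `2n` constraints are needed for this: if one is dropped, the others imply only members of
`smileyClosure` (`ImpliedWithout.mem_smileyClosure`). Other keys and the atoms `B_i ⊥ A_{i+1}` are
refuted by `coordTable`, the remaining unary atoms by a table built from a 3-colouring of the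
attributes.

Each member of the closure follows from a single element of `smiley`, so any `2n - 1` members follow
from `smiley` minus some element. Hence the closure is closed under `(2n - 1)`-ary finite
implication, and sound `k`-ary rules with `k ≤ 2n - 1` never lead from `smiley` to `k(A_i B_i)`. -/

namespace KeyIndep

/-! ### Monotonicity and counting for keys and atoms -/

section Satisfaction

variable {R : RelationSchema} {r : Relation R}

theorem Satisfies.key_mono {X Y : Set R.Attr} (h : X ⊆ Y) (hX : Satisfies r (.key X)) :
    Satisfies r (.key Y) :=
  fun t ht t' ht' hY => hX t ht t' ht' fun A hA => hY A (h hA)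

theorem Satisfies.indep_symm {X Y : Set R.Attr} (h : Satisfies r (.indep X Y)) :
    Satisfies r (.indep Y X) := fun t ht t' ht' => by
  obtain ⟨s, hs, h1, h2⟩ := h t' ht' t ht
  exact ⟨s, hs, h2, h1⟩

theorem Satisfies.indep_mono {X X' Y Y' : Set R.Attr} (hX : X' ⊆ X) (hY : Y' ⊆ Y)
    (h : Satisfies r (.indep X Y)) : Satisfies r (.indep X' Y') := fun t ht t' ht' => by
  obtain ⟨s, hs, h1, h2⟩ := h t ht t' ht'
  exact ⟨s, hs, fun A hA => h1 A (hX hA), fun A hA => h2 A (hY hA)⟩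

theorem satisfies_indep_of_eq_empty {X Y : Set R.Attr} (h : X = ∅ ∨ Y = ∅) :
    Satisfies r (.indep X Y) := fun t ht t' ht' => by
  rcases h with rfl | rfl
  · exact ⟨t', ht', fun A hA => hA.elim, fun A _ => rfl⟩
  · exact ⟨t, ht, fun A _ => rfl, fun A hA => hA.elim⟩

/-- If `A ⊥ B` holds, all pairs of values of `A` and `B` occur jointly. -/
theorem Satisfies.image_pair_eq {A B : R.Attr} (h : Satisfies r (.indep {A} {B})) :
    (fun t : Tuple R => (t A, t B)) '' r = ((fun t => t A) '' r) ×ˢ ((fun t => t B) '' r) := by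
  ext ⟨a, b⟩
  constructor
  · rintro ⟨t, ht, h⟩
    cases h
    exact ⟨⟨t, ht, rfl⟩, ⟨t, ht, rfl⟩⟩
  · rintro ⟨⟨t, ht, h1⟩, ⟨t', ht', h2⟩⟩
    obtain ⟨s, hs, h3, h4⟩ := h t ht t' ht'
    refine ⟨s, hs, Prod.ext ((h3 A rfl).trans h1) ((h4 B rfl).trans h2)⟩

theorem Satisfies.mul_ncard_le (hr : r.Finite) {A B : R.Attr}
    (h : Satisfies r (.indep {A} {B})) :
    ((fun t => t A) '' r).ncard * ((fun t => t B) '' r).ncard ≤ r.ncard := by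
  rw [← Set.ncard_prod, ← h.image_pair_eq]
  exact Set.ncard_image_le hr

theorem Satisfies.le_mul_ncard (hr : r.Finite) {A B : R.Attr} (h : Satisfies r (.key {A, B})) :
    r.ncard ≤ ((fun t => t A) '' r).ncard * ((fun t => t B) '' r).ncard := by
  rw [← Set.ncard_prod]
  refine Set.ncard_le_ncard_of_injOn (fun t => (t A, t B))
    (fun t ht => ⟨⟨t, ht, rfl⟩, ⟨t, ht, rfl⟩⟩) ?_ ((hr.image _).prod (hr.image _))
  intro t ht t' ht' hh
  refine h t ht t' ht' ?_
  rintro C (rfl | rfl)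
  · exact congrArg Prod.fst hh
  · exact congrArg Prod.snd hh

/-- By independence the projection to `(A, B)` is onto the product of the value sets; with no more
tuples than pairs it must be injective. -/
theorem Satisfies.key_of_ncard_le (hr : r.Finite) {A B : R.Attr}
    (h : Satisfies r (.indep {A} {B}))
    (hle : r.ncard ≤ ((fun t => t A) '' r).ncard * ((fun t => t B) '' r).ncard) :
    Satisfies r (.key {A, B}) := by
  rw [← Set.ncard_prod, ← h.image_pair_eq] at hle
  have hinj := (Set.ncard_image_iff hr).1 (le_antisymm (Set.ncard_image_le hr) hle)
  intro t ht t' ht' hh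
  exact hinj ht ht' (Prod.ext (hh A (Or.inl rfl)) (hh B (Or.inr rfl)))

end Satisfaction

/-! ### The cyclic order of the indices -/

section Cycle

variable {n : ℕ}

theorem cyclicSucc_val (i : Fin n) :
    (cyclicSucc i).1 = if i.1 + 1 = n then 0 else i.1 + 1 := by
  have := i.2
  unfold cyclicSucc
  split_ifs with h
  · simp [h]
  · exact Nat.mod_eq_of_lt (by omega)

theorem cyclicSucc_injective : Function.Injective (cyclicSucc (n := n)) := fun i j h => by
  have h := congrArg Fin.val h
  rw [cyclicSucc_val, cyclicSucc_val] at h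
  have := i.2
  have := j.2
  ext
  split_ifs at h <;> omega

theorem cyclicSucc_ne (hn : 2 ≤ n) (i : Fin n) : cyclicSucc i ≠ i := fun h => by
  have h := congrArg Fin.val h
  rw [cyclicSucc_val] at h
  split_ifs at h <;> omega

/-- The position of `i` in the cyclic order that starts right after `m` and ends in `m`. -/
def cyclicPos (m i : Fin n) : ℕ := if i ≤ m then i + n - m - 1 else i - m - 1

theorem cyclicPos_lt (m i : Fin n) : cyclicPos m i < n := by
  have := i.2
  have := m.2
  unfold cyclicPos
  split_ifs with h
  · have : i.1 ≤ m.1 := h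
    omega
  · omega

theorem cyclicPos_cyclicSucc {m i : Fin n} (h : i ≠ m) :
    cyclicPos m (cyclicSucc i) = cyclicPos m i + 1 := by
  have h' : i.1 ≠ m.1 := fun hh => h (Fin.ext hh)
  have := i.2
  have := m.2
  simp only [cyclicPos, Fin.le_def, cyclicSucc_val]
  split_ifs <;> omega

end Cycle

/-! ### Finite tables as countermodels -/

section Tables

variable {n : ℕ} (D : Fin n ⊕ Fin n → Type) [∀ a, Infinite (D a)]

/-- Every finite table with entries in a countable type is realized by a relation. -/
theorem exists_relation_of_table {V : Type} [Countable V] (T : Set (Fin n ⊕ Fin n → V))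
    (hT : T.Finite) :
    ∃ r : Relation (smileySchema n D), r.Finite ∧
      (∀ X : Set (Fin n ⊕ Fin n), Satisfies r (.key X) ↔
        ∀ t ∈ T, ∀ t' ∈ T, (∀ a ∈ X, t a = t' a) → t = t') ∧
      (∀ X Y : Set (Fin n ⊕ Fin n), Satisfies r (.indep X Y) ↔
        ∀ t ∈ T, ∀ t' ∈ T, ∃ s ∈ T, (∀ a ∈ X, s a = t a) ∧ ∀ a ∈ Y, s a = t' a) := by
  obtain ⟨f, hf⟩ := exists_injective_nat V
  let e : ∀ a, V → D a := fun a v => Infinite.natEmbedding (D a) (f v)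
  have he : ∀ a v w, e a v = e a w ↔ v = w := fun a v w =>
    ⟨fun h => hf ((Infinite.natEmbedding (D a)).injective h), fun h => h ▸ rfl⟩
  let g : (Fin n ⊕ Fin n → V) → Tuple (smileySchema n D) := fun t a => e a (t a)
  have hg : ∀ t t', g t = g t' ↔ t = t' := fun t t' =>
    ⟨fun h => funext fun a => (he a _ _).1 (congrFun h a), fun h => h ▸ rfl⟩
  have hagree : ∀ (X : Set (Fin n ⊕ Fin n)) t t',
      AgreeOn (R := smileySchema n D) X (g t) (g t') ↔ ∀ a ∈ X, t a = t' a := fun X t t' =>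
    forall₂_congr fun a _ => he a _ _
  refine ⟨g '' T, hT.image g, fun X => ?_, fun X Y => ?_⟩
  · simp only [Satisfies, Set.forall_mem_image, hagree, hg]
  · simp only [Satisfies, Set.forall_mem_image, Set.exists_mem_image, hagree]

/-- The elements of `smiley`, indexed by the attributes: the atoms by the `A_i`, the keys by
the `B_i`. -/
def smileyElem : Fin n ⊕ Fin n → Constraint (smileySchema n D)
  | .inl i => .indep {attrA D i} {attrB D i}
  | .inr i => .key {attrB D i, attrA D (cyclicSucc i)}

theorem smileyElem_mem (e : Fin n ⊕ Fin n) : smileyElem D e ∈ smiley D := by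
  cases e with
  | inl i => exact Or.inl ⟨i, rfl⟩
  | inr i => exact Or.inr ⟨i, rfl⟩

/-- `φ` follows, in finite relations, from all elements of `smiley` but the one with index `e`. -/
def ImpliedWithout (e : Fin n ⊕ Fin n) (φ : Constraint (smileySchema n D)) : Prop :=
  FinImplies (smileyElem D '' {e}ᶜ) φ

variable {D}

theorem ImpliedWithout.apply_table {e : Fin n ⊕ Fin n} {φ : Constraint (smileySchema n D)}
    (h : ImpliedWithout D e φ) {V : Type} [Countable V] (T : Set (Fin n ⊕ Fin n → V))
    (hT : T.Finite)
    (hI : ∀ i : Fin n, .inl i ≠ e → ∀ t ∈ T, ∀ t' ∈ T, ∃ s ∈ T,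
      s (.inl i) = t (.inl i) ∧ s (.inr i) = t' (.inr i))
    (hK : ∀ i : Fin n, .inr i ≠ e → ∀ t ∈ T, ∀ t' ∈ T, t (.inr i) = t' (.inr i) →
      t (.inl (cyclicSucc i)) = t' (.inl (cyclicSucc i)) → t = t') :
    match φ with
    | .key X => ∀ t ∈ T, ∀ t' ∈ T, (∀ a ∈ X, t a = t' a) → t = t'
    | .indep X Y => ∀ t ∈ T, ∀ t' ∈ T, ∃ s ∈ T, (∀ a ∈ X, s a = t a) ∧ ∀ a ∈ Y, s a = t' a := by
  obtain ⟨r, hr, hkey, hindep⟩ := exists_relation_of_table D T hT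
  have := h r hr (by
    rintro _ ⟨a, ha, rfl⟩
    cases a with
    | inl i =>
      refine (hindep {.inl i} {.inr i}).2 fun t ht t' ht' => ?_
      obtain ⟨s, hs, h1, h2⟩ := hI i ha t ht t' ht'
      exact ⟨s, hs, fun a ha => by cases ha; exact h1, fun a ha => by cases ha; exact h2⟩
    | inr i =>
      exact (hkey {.inr i, .inl (cyclicSucc i)}).2 fun t ht t' ht' hh =>
        hK i ha t ht t' ht' (hh _ (Or.inl rfl)) (hh _ (Or.inr rfl)))
  cases φ with
  | key X => exact (hkey X).1 this
  | indep X Y => exact (hindep X Y).1 this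

end Tables

/-! ### The coordinate table, refuting keys and `B_i ⊥ A_{i+1}` -/

section CoordinateTable

variable {n : ℕ}

/-- The coordinates recorded by each attribute in the counterexample that omits the element of
`smiley` with index `e`. -/
def coords (e : Fin n ⊕ Fin n) : Fin n ⊕ Fin n → Set (Fin n)
  | .inl i => {s | s.1 ≤ cyclicPos (Sum.elim id id e) i}
  | .inr i => {s | cyclicPos (Sum.elim id id e) i < s.1 ∨ e = .inl i}

theorem notMem_coords_inr {e : Fin n ⊕ Fin n} {i s : Fin n} (hi : .inl i ≠ e)
    (hs : s ∈ coords e (.inl i)) : s ∉ coords e (.inr i) := by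
  rintro (h | h)
  · exact absurd (show s.1 ≤ _ from hs) (by omega)
  · exact hi h.symm

theorem mem_coords_or {e : Fin n ⊕ Fin n} {i : Fin n} (hi : .inr i ≠ e) (s : Fin n) :
    s ∈ coords e (.inr i) ∨ s ∈ coords e (.inl (cyclicSucc i)) := by
  by_cases h : i = Sum.elim id id e
  · cases e with
    | inl m => exact Or.inl (Or.inr (congrArg Sum.inl h.symm))
    | inr m => exact (hi (congrArg Sum.inr h)).elim
  · have := cyclicPos_cyclicSucc h
    simp only [coords, Set.mem_ofPred_eq, this]
    omega

/-- The key attributes `B_i`, `A_{i+1}` overlap in a coordinate. This makes them dependent, and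
leaves room for a row that is inconsistent on every such overlap. -/
theorem exists_mem_coords {e : Fin n ⊕ Fin n} {i : Fin n} (hi : .inr i ≠ e) :
    ∃ s, s ∈ coords e (.inr i) ∧ s ∈ coords e (.inl (cyclicSucc i)) := by
  by_cases h : i = Sum.elim id id e
  · cases e with
    | inl m => exact ⟨⟨0, i.pos⟩, Or.inr (congrArg Sum.inl h.symm), Nat.zero_le _⟩
    | inr m => exact (hi (congrArg Sum.inr h)).elim
  · have h1 := cyclicPos_cyclicSucc h
    have h2 := cyclicPos_lt (Sum.elim id id e) (cyclicSucc i)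
    exact ⟨⟨cyclicPos (Sum.elim id id e) (cyclicSucc i), h2⟩, Or.inl (by simp [h1]),
      show cyclicPos _ _ ≤ cyclicPos _ _ from le_rfl⟩

open Classical in
/-- The row of the coordinate table given by a 0-1 vector. -/
noncomputable def coordRow (e : Fin n ⊕ Fin n) (u : Fin n → Bool) (a : Fin n ⊕ Fin n) :
    Fin n → Bool :=
  fun s => if s ∈ coords e a then u s else false

open Classical in
/-- A row outside the coordinate table that agrees with the zero row on `X`. -/
noncomputable def extraRow (e : Fin n ⊕ Fin n) (X : Set (Fin n ⊕ Fin n)) :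
    Fin n ⊕ Fin n → Fin n → Bool
  | .inl i => coordRow e (fun _ => decide (.inl i ∉ X)) (.inl i)
  | .inr i => coordRow e (fun _ => decide (.inl (cyclicSucc i) ∈ X)) (.inr i)

theorem coordRow_apply_of_mem {e : Fin n ⊕ Fin n} {u : Fin n → Bool} {a : Fin n ⊕ Fin n}
    {s : Fin n} (h : s ∈ coords e a) : coordRow e u a s = u s := if_pos h

/-- The table of all coordinate rows together with the extra row. -/
def coordTable (e : Fin n ⊕ Fin n) (X : Set (Fin n ⊕ Fin n)) :
    Set (Fin n ⊕ Fin n → Fin n → Bool) :=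
  insert (extraRow e X) (Set.range (coordRow e))

theorem exists_coordRow_eq {e : Fin n ⊕ Fin n} {X : Set (Fin n ⊕ Fin n)}
    {t : Fin n ⊕ Fin n → Fin n → Bool} (ht : t ∈ coordTable e X) (a : Fin n ⊕ Fin n) :
    ∃ u, coordRow e u a = t a := by
  rcases ht with rfl | ⟨u, rfl⟩
  · cases a <;> exact ⟨_, rfl⟩
  · exact ⟨u, rfl⟩

theorem coordTable_indep {e : Fin n ⊕ Fin n} {X : Set (Fin n ⊕ Fin n)} {i : Fin n}
    (hi : .inl i ≠ e) {t t' : Fin n ⊕ Fin n → Fin n → Bool} (ht : t ∈ coordTable e X)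
    (ht' : t' ∈ coordTable e X) :
    ∃ s ∈ coordTable e X, s (.inl i) = t (.inl i) ∧ s (.inr i) = t' (.inr i) := by
  classical
  obtain ⟨u, hu⟩ := exists_coordRow_eq ht (.inl i)
  obtain ⟨u', hu'⟩ := exists_coordRow_eq ht' (.inr i)
  -- For a retained atom the coordinates of `A_i` and `B_i` are disjoint, so the two vectors can be
  -- spliced.
  refine ⟨coordRow e fun s => if s ∈ coords e (.inl i) then u s else u' s,
    Or.inr ⟨_, rfl⟩, ?_, ?_⟩
  · rw [← hu]
    funext s
    by_cases h : s ∈ coords e (.inl i) <;> simp [coordRow, h]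
  · rw [← hu']
    funext s
    by_cases h : s ∈ coords e (.inl i)
    · simp [coordRow, notMem_coords_inr hi h]
    · simp [coordRow, h]

/-- On a shared coordinate the extra row has opposite bits at `B_i` and `A_{i+1}`, whatever `X` is,
while a coordinate row has equal ones. Hence adding the extra row violates no retained key. -/
theorem not_coordRow_eq_extraRow {e : Fin n ⊕ Fin n} (X : Set (Fin n ⊕ Fin n)) {i : Fin n}
    (hi : .inr i ≠ e) {u : Fin n → Bool} (h1 : coordRow e u (.inr i) = extraRow e X (.inr i))
    (h2 : coordRow e u (.inl (cyclicSucc i)) = extraRow e X (.inl (cyclicSucc i))) : False := by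
  obtain ⟨s, hs1, hs2⟩ := exists_mem_coords hi
  have h1 := congrFun h1 s
  have h2 := congrFun h2 s
  simp only [extraRow, coordRow_apply_of_mem hs1, coordRow_apply_of_mem hs2] at h1 h2
  rw [h1] at h2
  by_cases h : (.inl (cyclicSucc i) : Fin n ⊕ Fin n) ∈ X <;> simp [h] at h2

theorem coordTable_key {e : Fin n ⊕ Fin n} {X : Set (Fin n ⊕ Fin n)} {i : Fin n}
    (hi : .inr i ≠ e) {t t' : Fin n ⊕ Fin n → Fin n → Bool} (ht : t ∈ coordTable e X)
    (ht' : t' ∈ coordTable e X) (h1 : t (.inr i) = t' (.inr i))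
    (h2 : t (.inl (cyclicSucc i)) = t' (.inl (cyclicSucc i))) : t = t' := by
  rcases ht with rfl | ⟨u, rfl⟩ <;> rcases ht' with rfl | ⟨u', rfl⟩
  · rfl
  · exact (not_coordRow_eq_extraRow X hi h1.symm h2.symm).elim
  · exact (not_coordRow_eq_extraRow X hi h1 h2).elim
  · congr 1
    funext s
    rcases mem_coords_or hi s with hs | hs
    · simpa only [coordRow_apply_of_mem hs] using congrFun h1 s
    · simpa only [coordRow_apply_of_mem hs] using congrFun h2 s

theorem coordTable_finite (e : Fin n ⊕ Fin n) (X : Set (Fin n ⊕ Fin n)) :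
    (coordTable e X).Finite := (Set.finite_range _).insert _

theorem not_coordTable_key (hn : 2 ≤ n) (e : Fin n ⊕ Fin n) {X : Set (Fin n ⊕ Fin n)}
    (hX : ∀ i : Fin n, .inr i ∈ X → .inl (cyclicSucc i) ∉ X) :
    ¬ ∀ t ∈ coordTable e X, ∀ t' ∈ coordTable e X, (∀ a ∈ X, t a = t' a) → t = t' := by
  intro h
  -- A retained key is needed to tell the extra row from the zero row; `n ≥ 2` provides one.
  obtain ⟨i, hi⟩ : ∃ i : Fin n, .inr i ≠ e := by
    by_cases h0 : (.inr ⟨0, by omega⟩ : Fin n ⊕ Fin n) = e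
    · refine ⟨⟨1, by omega⟩, fun h1 => ?_⟩
      have := h0.trans h1.symm
      simp at this
    · exact ⟨_, h0⟩
  have := h (coordRow e fun _ => false) (Or.inr ⟨_, rfl⟩) (extraRow e X) (Or.inl rfl) (by
    rintro (i | i) hi
    · simp [extraRow, hi]
    · simp [extraRow, hX i hi])
  exact not_coordRow_eq_extraRow X hi (congrFun this _) (congrFun this _)

theorem not_coordTable_indep {e : Fin n ⊕ Fin n} {i : Fin n} (hi : .inr i ≠ e) :
    ¬ ∀ t ∈ coordTable e ∅, ∀ t' ∈ coordTable e ∅, ∃ s ∈ coordTable e ∅,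
      s (.inr i) = t (.inr i) ∧ s (.inl (cyclicSucc i)) = t' (.inl (cyclicSucc i)) := by
  intro h
  obtain ⟨t, ht, h1, h2⟩ := h (coordRow e fun _ => true) (Or.inr ⟨_, rfl⟩)
    (coordRow e fun _ => false) (Or.inr ⟨_, rfl⟩)
  obtain ⟨s, hs1, hs2⟩ := exists_mem_coords hi
  have h1 := congrFun h1 s
  have h2 := congrFun h2 s
  rcases ht with rfl | ⟨u, rfl⟩
  · simp [extraRow, coordRow_apply_of_mem hs1] at h1
  · simp only [coordRow_apply_of_mem hs1, coordRow_apply_of_mem hs2] at h1 h2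
    simp [h1] at h2

end CoordinateTable

/-! ### Tables from 3-colourings -/

section ColorTable

/-- Three pairwise independent functions of two bits. -/
def colorBit (c : Fin 3) (p : Bool × Bool) : Bool := ![p.1, p.2, xor p.1 p.2] c

theorem exists_colorBit_eq : ∀ c d : Fin 3, c ≠ d → ∀ x y : Bool,
    ∃ p, colorBit c p = x ∧ colorBit d p = y := by decide

theorem colorBit_pair_injective : ∀ c d : Fin 3, c ≠ d → ∀ p q : Bool × Bool,
    colorBit c p = colorBit c q → colorBit d p = colorBit d q → p = q := by decide

variable {n : ℕ} {D : Fin n ⊕ Fin n → Type} [∀ a, Infinite (D a)]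

/-- Let each attribute record the bit of its colour. Two different colours are independent and
determine the row, so a colouring proper on the retained pairs satisfies all retained constraints,
while equally coloured attributes are dependent. -/
theorem ImpliedWithout.color_ne {e x y : Fin n ⊕ Fin n}
    (h : ImpliedWithout D e (.indep ({x} : Set (Fin n ⊕ Fin n)) ({y} : Set (Fin n ⊕ Fin n))))
    (c : Fin n ⊕ Fin n → Fin 3) (hI : ∀ i : Fin n, .inl i ≠ e → c (.inl i) ≠ c (.inr i))
    (hK : ∀ i : Fin n, .inr i ≠ e → c (.inr i) ≠ c (.inl (cyclicSucc i))) : c x ≠ c y := by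
  intro hc
  have := h.apply_table (Set.range fun p a => colorBit (c a) p) (Set.finite_range _)
    (by
      rintro i hi _ ⟨p, rfl⟩ _ ⟨q, rfl⟩
      obtain ⟨s, hs⟩ := exists_colorBit_eq _ _ (hI i hi) (colorBit (c (.inl i)) p)
        (colorBit (c (.inr i)) q)
      exact ⟨_, ⟨s, rfl⟩, hs⟩)
    (by
      rintro i hi _ ⟨p, rfl⟩ _ ⟨q, rfl⟩ h1 h2
      rw [colorBit_pair_injective _ _ (hK i hi) p q h1 h2])
  -- The second colour serves only to show that the bit of colour `c x` takes both values.
  obtain ⟨d, hd⟩ : ∃ d, c x ≠ d := (exists_ne (c x)).imp fun _ => Ne.symm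
  obtain ⟨p, hp, -⟩ := exists_colorBit_eq _ _ hd true true
  obtain ⟨q, hq, -⟩ := exists_colorBit_eq _ _ hd false true
  obtain ⟨_, ⟨s, rfl⟩, h1, h2⟩ := this _ ⟨p, rfl⟩ _ ⟨q, rfl⟩
  have h1 := h1 x rfl
  have h2 := h2 y rfl
  simp only [← hc, hp, hq] at h1 h2
  simp [h1] at h2

end ColorTable

/-! ### Consequences of all but one constraint, and the closure -/

section Closure

variable {n : ℕ} {D : Fin n ⊕ Fin n → Type} [∀ a, Infinite (D a)]

theorem ImpliedWithout.exists_key_subset (hn : 2 ≤ n) {e : Fin n ⊕ Fin n}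
    {X : Set (Fin n ⊕ Fin n)} (h : ImpliedWithout D e (.key X)) :
    ∃ i : Fin n, .inr i ∈ X ∧ .inl (cyclicSucc i) ∈ X := by
  by_contra! hX
  exact not_coordTable_key hn e hX <| h.apply_table (coordTable e X) (coordTable_finite e X)
    (fun i hi t ht t' ht' => coordTable_indep hi ht ht')
    (fun i hi t ht t' ht' => coordTable_key hi ht ht')

theorem ImpliedWithout.indep_symm {e : Fin n ⊕ Fin n} {X Y : Set (Fin n ⊕ Fin n)}
    (h : ImpliedWithout D e (.indep X Y)) : ImpliedWithout D e (.indep Y X) :=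
  fun r hr hS => (h r hr hS).indep_symm

theorem not_impliedWithout_indep {e : Fin n ⊕ Fin n} {i : Fin n} (hi : .inr i ≠ e) :
    ¬ ImpliedWithout D e (.indep ({.inr i} : Set (Fin n ⊕ Fin n))
      ({.inl (cyclicSucc i)} : Set (Fin n ⊕ Fin n))) := by
  intro h
  refine not_coordTable_indep hi fun t ht t' ht' => ?_
  obtain ⟨s, hs, h1, h2⟩ := h.apply_table (coordTable e ∅) (coordTable_finite e ∅)
    (fun i hi t ht t' ht' => coordTable_indep hi ht ht')
    (fun i hi t ht t' ht' => coordTable_key hi ht ht') t ht t' ht'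
  exact ⟨s, hs, h1 _ rfl, h2 _ rfl⟩

theorem ImpliedWithout.unary_indep {e x y : Fin n ⊕ Fin n}
    (h : ImpliedWithout D e (.indep ({x} : Set (Fin n ⊕ Fin n)) ({y} : Set (Fin n ⊕ Fin n)))) :
    ∃ i : Fin n, (x = .inl i ∧ y = .inr i) ∨ (x = .inr i ∧ y = .inl i) := by
  classical
  by_contra! hxy
  -- Giving `x` and `y` a private common colour is proper unless they form a retained pair. Pairs
  -- `A_i`, `B_i` are excluded by `hxy`; pairs `B_i`, `A_{i+1}` by the coordinate table.
  refine h.color_ne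
    (fun v => if v = x ∨ v = y then 0 else Sum.elim (fun _ => 1) (fun _ => 2) v) ?_ ?_ (by simp)
  · intro i _
    have h1 := (hxy i).1
    have h2 := (hxy i).2
    split_ifs with hA hB <;> simp
    rcases hA with rfl | rfl <;> rcases hB with hB | hB
    · cases hB
    · exact h1 rfl hB.symm
    · exact h2 hB.symm rfl
    · cases hB
  · intro i hi
    split_ifs with hB hA <;> simp
    rcases hB with rfl | rfl <;> rcases hA with hA | hA
    · cases hA
    · subst hA
      exact not_impliedWithout_indep hi h
    · subst hA
      exact not_impliedWithout_indep hi h.indep_symm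
    · cases hA

variable (D) in
/-- The closure of `smiley` together with all trivial independence atoms. -/
def smileyClosure : Set (Constraint (smileySchema n D)) :=
  upwardClosure (smiley D) ∪ {φ | ∃ X Y, (X = ∅ ∨ Y = ∅) ∧ φ = .indep X Y}

theorem indep_mem_smileyClosure (i : Fin n) :
    Constraint.indep {attrA D i} {attrB D i} ∈ smileyClosure D ∧
      Constraint.indep {attrB D i} {attrA D i} ∈ smileyClosure D :=
  ⟨Or.inl (Or.inl (Or.inl (smileyElem_mem D (.inl i)))),
    Or.inl (Or.inr ⟨_, _, smileyElem_mem D (.inl i), rfl⟩)⟩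

theorem ImpliedWithout.mem_smileyClosure (hn : 2 ≤ n) {e : Fin n ⊕ Fin n}
    {φ : Constraint (smileySchema n D)} (h : ImpliedWithout D e φ) : φ ∈ smileyClosure D := by
  cases φ with
  | key X =>
    obtain ⟨i, h1, h2⟩ := h.exists_key_subset hn
    refine Or.inl (Or.inl (Or.inr ⟨_, X, ?_, smileyElem_mem D (.inr i), rfl⟩))
    rintro a (rfl | rfl)
    · exact h1
    · exact h2
  | indep X Y =>
    rcases X.eq_empty_or_nonempty with hX | ⟨x, hx⟩
    · exact Or.inr ⟨X, Y, Or.inl hX, rfl⟩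
    rcases Y.eq_empty_or_nonempty with hY | ⟨y, hy⟩
    · exact Or.inr ⟨X, Y, Or.inr hY, rfl⟩
    -- Every pair across the atom is some `A_i`, `B_i`, and each attribute has just one partner, so
    -- both sides are singletons.
    have key : ∀ x' ∈ X, ∀ y' ∈ Y, ∃ i : Fin n,
        (x' = Sum.inl i ∧ y' = Sum.inr i) ∨ (x' = Sum.inr i ∧ y' = Sum.inl i) :=
      fun x' hx' y' hy' => ImpliedWithout.unary_indep (D := D) (e := e) fun r hr hS =>
        (h r hr hS).indep_mono (Set.singleton_subset_iff.2 hx') (Set.singleton_subset_iff.2 hy')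
    have hX : X = {x} := by
      refine Set.eq_singleton_iff_unique_mem.2 ⟨hx, fun x' hx' => ?_⟩
      obtain ⟨i, ⟨h1, h2⟩ | ⟨h1, h2⟩⟩ := key x hx y hy <;>
      obtain ⟨j, ⟨h3, h4⟩ | ⟨h3, h4⟩⟩ := key x' hx' y hy <;>
      · subst h1 h3
        cases h2.symm.trans h4 <;> rfl
    have hY : Y = {y} := by
      refine Set.eq_singleton_iff_unique_mem.2 ⟨hy, fun y' hy' => ?_⟩
      obtain ⟨i, ⟨h1, h2⟩ | ⟨h1, h2⟩⟩ := key x hx y hy <;>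
      obtain ⟨j, ⟨h3, h4⟩ | ⟨h3, h4⟩⟩ := key x hx y' hy' <;>
      · subst h2 h4
        cases h1.symm.trans h3 <;> rfl
    obtain ⟨i, ⟨h1, h2⟩ | ⟨h1, h2⟩⟩ := key x hx y hy
    · rw [hX, hY, h1, h2]
      exact (indep_mem_smileyClosure i).1
    · rw [hX, hY, h1, h2]
      exact (indep_mem_smileyClosure i).2

theorem exists_smileyElem_imp (hn : 2 ≤ n) {φ : Constraint (smileySchema n D)}
    (h : φ ∈ smileyClosure D) :
    ∃ e, ∀ r, Satisfies r (smileyElem D e) → Satisfies r φ := by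
  rcases h with ((h | ⟨X, X', hX, h, rfl⟩) | ⟨X, Y, h, rfl⟩) | ⟨X, Y, h, rfl⟩
  · rcases h with ⟨i, rfl⟩ | ⟨i, rfl⟩
    · exact ⟨.inl i, fun r hr => hr⟩
    · exact ⟨.inr i, fun r hr => hr⟩
  · rcases h with ⟨i, h⟩ | ⟨i, h⟩
    · cases h
    · cases h
      exact ⟨.inr i, fun r hr => Satisfies.key_mono hX hr⟩
  · rcases h with ⟨i, h⟩ | ⟨i, h⟩
    · cases h
      exact ⟨.inl i, fun r hr => Satisfies.indep_symm hr⟩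
    · cases h
  · exact ⟨.inl ⟨0, by omega⟩, fun r _ => satisfies_indep_of_eq_empty h⟩

/-- The closure of `smiley` is closed under `(2n - 1)`-ary finite implication. -/
theorem IsKaryFinImplication.mem_smileyClosure (hn : 2 ≤ n) {φ : Constraint (smileySchema n D)}
    (h : IsKaryFinImplication (2 * n - 1) (smileyClosure D) φ) : φ ∈ smileyClosure D := by
  obtain ⟨S, hS, hcard, himp⟩ := h
  have : Nonempty (Fin n ⊕ Fin n) := ⟨.inl ⟨0, by omega⟩⟩
  choose! g hg using fun ψ (hψ : ψ ∈ smileyClosure D) => exists_smileyElem_imp hn hψ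
  -- At most `2n - 1` premises cannot use all `2n` elements of `smiley`.
  obtain ⟨e, he⟩ : ∃ e, e ∉ g '' S := by
    by_contra! hall
    have h1 : (g '' S).encard ≤ ((2 * n - 1 : ℕ) : ℕ∞) := (Set.encard_image_le g S).trans hcard
    rw [Set.eq_univ_of_forall hall, Set.encard_univ, ENat.card_eq_coe_fintype_card] at h1
    have h1 := Nat.cast_le.1 h1
    simp at h1
    omega
  refine ImpliedWithout.mem_smileyClosure hn (e := e) fun r hr hr' => himp r hr fun ψ hψ => ?_
  refine hg ψ (hS hψ) r (hr' _ ⟨g ψ, fun hge => he ⟨ψ, hψ, hge⟩, rfl⟩)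

/-! ### The counting argument, and the key outside the closure -/

variable (D) in
theorem finImplies_smiley (i : Fin n) :
    FinImplies (smiley D) (.key {attrA D i, attrB D i}) := by
  intro r hr hS
  have hI : ∀ j, Satisfies r (.indep {attrA D j} {attrB D j}) := fun j =>
    hS _ (smileyElem_mem D (.inl j))
  have hK : ∀ j, Satisfies r (.key {attrB D j, attrA D (cyclicSucc j)}) := fun j =>
    hS _ (smileyElem_mem D (.inr j))
  refine (hI i).key_of_ncard_le hr ?_
  by_contra! hlt
  set a : Fin n → ℕ := fun j => ((fun t => t (attrA D j)) '' r).ncard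
  set b : Fin n → ℕ := fun j => ((fun t => t (attrB D j)) '' r).ncard
  have hab : ∀ j, a j * b j ≤ r.ncard := fun j => (hI j).mul_ncard_le hr
  have hba : ∀ j, r.ncard ≤ b j * a (cyclicSucc j) := fun j => (hK j).le_mul_ncard hr
  have hpos : 0 < r.ncard := lt_of_le_of_lt (Nat.zero_le _) hlt
  have hprod : ∏ j, b j * a (cyclicSucc j) = ∏ j, a j * b j := by
    have hbij : Function.Bijective (cyclicSucc (n := n)) :=
      Finite.injective_iff_bijective.1 cyclicSucc_injective
    rw [Finset.prod_mul_distrib, Finset.prod_mul_distrib, hbij.prod_comp a, mul_comm]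
  have h1 : ∏ _j : Fin n, r.ncard ≤ ∏ j, b j * a (cyclicSucc j) :=
    Finset.prod_le_prod' fun j _ => hba j
  -- One strict factor makes the product strictly smaller only if the factors are positive.
  have h0 : ∀ j, 0 < a j * b j := by
    have : 0 < ∏ j, a j * b j := hprod ▸ lt_of_lt_of_le (Finset.prod_pos fun _ _ => hpos) h1
    exact fun j => Nat.pos_of_ne_zero fun hj =>
      this.ne' (Finset.prod_eq_zero (Finset.mem_univ j) hj)
  have h2 : ∏ j, a j * b j < ∏ _j : Fin n, r.ncard :=
    Finset.prod_lt_prod (fun j _ => h0 j) (fun j _ => hab j) ⟨i, Finset.mem_univ i, hlt⟩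
  omega

variable (D) in
theorem key_notMem_smileyClosure (hn : 2 ≤ n) (i : Fin n) :
    Constraint.key {attrA D i, attrB D i} ∉ smileyClosure D := by
  have key : ∀ X ⊆ {attrA D i, attrB D i}, Constraint.key X ∉ smiley D := by
    rintro X hX (⟨j, h⟩ | ⟨j, h⟩)
    · cases h
    · cases h
      have h1 : j = i := by
        rcases hX (Or.inl rfl) with h | h
        · cases h
        · exact Sum.inr_injective h
      have h2 : cyclicSucc j = i := by
        rcases hX (Or.inr rfl) with h | h
        · exact Sum.inl_injective h
        · cases h
      exact cyclicSucc_ne hn i (h1 ▸ h2)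
  rintro (((h | ⟨X, X', hX, h, hh⟩) | ⟨X, Y, h, hh⟩) | ⟨X, Y, h, hh⟩)
  · exact key _ subset_rfl h
  · cases hh
    exact key X hX h
  · cases hh
  · cases hh

theorem mem_upwardClosure_of_mem_smileyClosure {φ : Constraint (smileySchema n D)}
    (h : φ ∈ smileyClosure D) (hφ : φ ∈ keysAndUnaryAtoms (smileySchema n D)) :
    φ ∈ upwardClosure (smiley D) := by
  rcases h with h | ⟨X, Y, h, rfl⟩
  · exact h
  · rcases hφ with ⟨Z, hZ⟩ | ⟨A, B, hAB⟩
    · cases hZ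
    · cases hAB
      rcases h with h | h <;> exact (Set.singleton_ne_empty _ h).elim

theorem smiley_subset_keysAndUnaryAtoms :
    smiley D ⊆ keysAndUnaryAtoms (smileySchema n D) := by
  rintro φ (⟨i, rfl⟩ | ⟨i, rfl⟩)
  · exact Or.inr ⟨_, _, rfl⟩
  · exact Or.inl ⟨_, rfl⟩

end Closure

/-! ### From closure under implication to inference rules -/

section Rules

/-- A single application of a rule is an inference from its premises. -/
theorem Infers.of_instance {L : ConstraintClass} {I : Set InferenceRule} {R : RelationSchema}
    {ρ : InferenceRule} (hρ : ρ ∈ I) {p : Fin ρ.arity → Constraint R} {φ : Constraint R}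
    (hp : ∀ j, p j ∈ L R) (hφ : φ ∈ L R) (h : ρ.Instance R p φ) :
    Infers L I (Set.range p) φ := by
  refine ⟨ρ.arity, Fin.snoc (α := fun _ => Constraint R) p φ, Fin.snoc_last _ _, fun i => ?_⟩
  refine Fin.lastCases ?_ (fun j => ?_) i
  · simp only [Fin.snoc_last]
    exact ⟨hφ, Or.inr ⟨ρ, hρ, p, fun j => ⟨j.castSucc, Fin.castSucc_lt_last j, by simp⟩, h⟩⟩
  · simp only [Fin.snoc_castSucc]
    exact ⟨hp j, Or.inl ⟨j, rfl⟩⟩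

/-- Sets closed under `k`-ary finite implication are closed under inference by sound `k`-ary
rules. -/
theorem Infers.mem_of_closed {L : ConstraintClass} {I : Set InferenceRule} {k : ℕ}
    (hk : IsKary k I) (hI : FinSound L I) {R : RelationSchema} {S C : Set (Constraint R)}
    (hS : S ⊆ C) (hC : ∀ φ, IsKaryFinImplication k C φ → φ ∈ C) {φ : Constraint R}
    (h : Infers L I S φ) : φ ∈ C := by
  obtain ⟨m, γ, rfl, hγ⟩ := h
  suffices ∀ i, γ i ∈ C from this _
  intro i
  induction i using WellFoundedLT.induction with
  | ind i ih =>
    obtain ⟨hL, h | ⟨ρ, hρ, p, hp, h⟩⟩ := hγ i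
    · exact hS h
    · have hpL : ∀ j, p j ∈ L R := fun j => by
        obtain ⟨i', -, h⟩ := hp j
        exact h ▸ (hγ i').1
      refine hC _ ⟨Set.range p, ?_, ?_, hI R _ _ ?_ hL (.of_instance hρ hpL hL h)⟩
      · rintro _ ⟨j, rfl⟩
        obtain ⟨i', hi', h⟩ := hp j
        exact h ▸ ih i' hi'
      · rw [← Set.image_univ]
        refine (Set.encard_image_le _ _).trans ?_
        rw [Set.encard_univ, ENat.card_eq_coe_fintype_card, Fintype.card_fin]
        exact_mod_cast hk ρ hρ
      · rintro _ ⟨j, rfl⟩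
        exact hpL j

theorem not_exists_kary (L : ConstraintClass) (k : ℕ) :
    ¬ ∃ I : Set InferenceRule, IsKary k I ∧ FinSound L I ∧
      FinComplete L keysAndUnaryAtoms I := by
  rintro ⟨I, hk, hsound, hcomplete⟩
  -- The choice `n = k + 2` ensures both `n ≥ 2` and `k ≤ 2n - 1`.
  have hn : 2 ≤ k + 2 := by omega
  let D : Fin (k + 2) ⊕ Fin (k + 2) → Type := fun _ => ℕ
  refine key_notMem_smileyClosure D hn 0 (Infers.mem_of_closed hk hsound (S := smiley D)
    (fun φ h => Or.inl (Or.inl (Or.inl h))) ?_ (hcomplete _ _ _ smiley_subset_keysAndUnaryAtoms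
      (Or.inl ⟨_, rfl⟩) (finImplies_smiley D 0)))
  rintro φ ⟨S, hS, hcard, h⟩
  refine IsKaryFinImplication.mem_smileyClosure hn ⟨S, hS, hcard.trans ?_, h⟩
  exact_mod_cast (by omega : k ≤ 2 * (k + 2) - 1)

end Rules

end KeyIndep

theorem mainTheorem2 :
    -- no `k`-ary axiomatization for keys and unary independence atoms
    (∀ k : ℕ, ¬ ∃ I : Set InferenceRule, IsKary k I ∧
      FinSound keysAndUnaryAtoms I ∧ FinComplete keysAndUnaryAtoms keysAndUnaryAtoms I) ∧
    -- not even if arbitrary independence atoms may occur in inferences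
    (∀ k : ℕ, ¬ ∃ I : Set InferenceRule, IsKary k I ∧
      FinSound keysAndAtoms I ∧ FinComplete keysAndAtoms keysAndUnaryAtoms I) ∧
    -- the smiley sets
    (∀ (n : ℕ) (hn : 2 ≤ n) (D : Fin n ⊕ Fin n → Type) [∀ a, Infinite (D a)],
      FinImplies (smiley D) (.key {attrA D ⟨0, by omega⟩, attrB D ⟨0, by omega⟩}) ∧
      .key {attrA D ⟨0, by omega⟩, attrB D ⟨0, by omega⟩} ∉ upwardClosure (smiley D) ∧
      ∀ φ ∈ keysAndUnaryAtoms (smileySchema n D),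
        IsKaryFinImplication (2 * n - 1) (upwardClosure (smiley D)) φ →
          φ ∈ upwardClosure (smiley D)) := by
  refine ⟨not_exists_kary _, not_exists_kary _, fun n hn D _ => ⟨finImplies_smiley D _,
    fun h => key_notMem_smileyClosure D hn _ (Or.inl h), fun φ hφ h => ?_⟩⟩
  obtain ⟨S, hS, hcard, himp⟩ := h
  exact mem_upwardClosure_of_mem_smileyClosure (IsKaryFinImplication.mem_smileyClosure hn
    ⟨S, fun ψ hψ => Or.inl (hS hψ), hcard, himp⟩) hφ
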